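/- Let $(B,g_B)$ and $(F,g_F)$ be smooth pseudo-Riemannian manifolds (without boundary) of dimensions $m\ge 3$ and $k\ge 1$, and let $\psi\in C^\infty(B)$ with $\psi>0$. Put $\overline\mu=-\frac{k}{m-2}$ and $\overline\mu_\pm=\overline\mu\pm\sqrt{\overline\mu^2-\overline\mu}$, let $\mu\in\mathbb R\setminus\{0,1,\overline\mu,\overline\mu_+,\overline\mu_-\}$, and set $$\alpha^{\Delta}=\frac{1}{(m-2)\mu+k},\qquad \beta^{\Delta}=\frac{\mu}{(m-2)\mu+k},$$ $$\alpha^{H}=\frac{-[(m-2)\mu+k]}{\mu[(m-2)\mu+k]+k(\mu-1)},\qquad \beta^{H}=\frac{[(m-2)\mu+k]^2}{\mu[(m-2)\mu+k]+k(\mu-1)}.$$ Let $\mathrm{Ric}$ be the Ricci tensor of the product manifold $B\times F$ with the metric $g=\psi^{2\mu}g_B+\psi^2g_F$, that is, $g=(\psi\circ\pi)^{2\mu}\pi^*g_B+(\psi\circ\pi)^2\sigma^*g_F$ for the projections $\pi:B\times F\to B$, $\sigma:B\times F\to F$. Let $\mathrm{Ric}_B$, $\mathrm{Ric}_F$ be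 the Ricci tensors of $g_B$, $g_F$, let $\mathrm H_B^f$ be the Hessian and $\Delta_Bf$ the Laplace–Beltrami operator of $f$ with respect to $g_B$. (Conventions: $R(X,Y)Z=\nabla_X\nabla_YZ-\nabla_Y\nabla_XZ-\nabla_{[X,Y]}Z$; $\mathrm{Ric}(X,Y)$ is the trace of $Z\mapsto R(Z,Y)X$; $\mathrm H^f(X,Y)=XYf-(\nabla_XY)f$; $\Delta f$ is the metric trace of $\mathrm H^f$.) Then at every $(p,q)\in B\times F$, for $X,Y\in T_pB$ and $V,W\in T_qF$, identified with their lifts to $T_{(p,q)}(B\times F)$, $$\mathrm{Ric}(X,Y)=\mathrm{Ric}_B(X,Y)+\beta^{H}\frac{1}{\psi^{1/\alpha^{H}}}\mathrm H_B^{\psi^{1/\alpha^{H}}}(X,Y)-\beta^{\Delta}\frac{1}{\psi^{1/\alpha^{\Delta}}}\,\Delta_B\psi^{1/\alpha^{\Delta}}\;g_B(X,Y),$$ $$\mathrm{Ric}(X,V)=\mathrm{Ric}(V,X)=0,$$ $$\mathrm{Ric}(V,W)=\mathrm{Ric}_F(V,W)-\frac{1}{\psi^{2(\mu-1)}}\,\frac{\beta^{\Delta}}{\mu}\,\frac{1}{\psi^{1/\alpha^{\Delta}}}\,\Delta_B\psi^{1/\alpha^{\Delta}}\;g_F(V,W),$$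 where the functions of $B$ are evaluated at $p$. -/

import Mathlib

set_option maxSynthPendingDepth 3
set_option linter.unusedSectionVars false

open Bundle Module
open scoped Manifold ContDiff

noncomputable section

/-- A pseudo-Riemannian metric on a manifold `M`: a smooth field of nondegenerate symmetric
bilinear forms on the tangent spaces (of arbitrary signature). -/
structure PseudoRiemannianMetric {E : Type*} [NormedAddCommGroup E] [NormedSpace ℝ E]
    {H : Type*} [TopologicalSpace H] (I : ModelWithCorners ℝ E H)
    (M : Type*) [TopologicalSpace M] [ChartedSpace H M] [IsManifold I ∞ M] where
  inner (x : M) : TangentSpace I x →L[ℝ] TangentSpace I x →L[ℝ] ℝ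
  symm (x : M) (v w : TangentSpace I x) : inner x v w = inner x w v
  nondegenerate (x : M) (v : TangentSpace I x) (hv : ∀ w, inner x v w = 0) : v = 0
  contMDiff : ContMDiff I (I.prod 𝓘(ℝ, E →L[ℝ] E →L[ℝ] ℝ)) ∞
    (fun x ↦ TotalSpace.mk' (E →L[ℝ] E →L[ℝ] ℝ)
      (E := fun x : M ↦ TangentSpace I x →L[ℝ] TangentSpace I x →L[ℝ] ℝ) x (inner x))

/-! ### Metrics, connections and curvature in a coordinate domain

Here `G : E → E →L[ℝ] E →L[ℝ] ℝ` is the coordinate expression of a metric, so `G y u v` is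
`g(u, v)` at the point with coordinates `y`, for the constant coordinate fields `u`, `v`. -/

namespace LocalMetric

variable {E : Type*} [NormedAddCommGroup E] [NormedSpace ℝ E]
  {E' : Type*} [NormedAddCommGroup E'] [NormedSpace ℝ E']

/-- Pull-back of bilinear forms under a linear map: `pullback A φ u v = φ (A u) (A v)`. -/
def pullback (A : E' →L[ℝ] E) : (E →L[ℝ] E →L[ℝ] ℝ) →L[ℝ] E' →L[ℝ] E' →L[ℝ] ℝ :=
  (ContinuousLinearMap.compL ℝ E' E (E' →L[ℝ] ℝ)).flip A ∘L
    ContinuousLinearMap.compL ℝ E (E →L[ℝ] ℝ) (E' →L[ℝ] ℝ)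
      ((ContinuousLinearMap.compL ℝ E' E ℝ).flip A)

theorem pullback_apply (A : E' →L[ℝ] E) (φ : E →L[ℝ] E →L[ℝ] ℝ) (u v : E') :
    pullback A φ u v = φ (A u) (A v) := rfl

/-- `christoffelLower G y u v w = ½ (∂ᵤ G(v, w) + ∂ᵥ G(u, w) - ∂_w G(u, v))` at `y`. -/
def christoffelLower (G : E → E →L[ℝ] E →L[ℝ] ℝ) (y : E) : E →L[ℝ] E →L[ℝ] E →L[ℝ] ℝ :=
  (1 / 2 : ℝ) • (fderiv ℝ G y + (fderiv ℝ G y).flip -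
    (ContinuousLinearMap.flipₗᵢ ℝ E E ℝ).toContinuousLinearEquiv.toContinuousLinearMap ∘L
      (fderiv ℝ G y).flip)

theorem christoffelLower_apply (G : E → E →L[ℝ] E →L[ℝ] ℝ) (y u v w : E) :
    christoffelLower G y u v w =
      1 / 2 * (fderiv ℝ G y u v w + fderiv ℝ G y v u w - fderiv ℝ G y w u v) := by
  simp [christoffelLower]

/-- The Christoffel symbols of the Levi-Civita connection: `christoffel G y u v` is the value at
`y` of `∇ᵤ v` for constant fields `u`, `v`, that is, the vector `Γ` with
`G y Γ w = christoffelLower G y u v w` for all `w`. -/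
def christoffel (G : E → E →L[ℝ] E →L[ℝ] ℝ) (y : E) : E →L[ℝ] E →L[ℝ] E :=
  ContinuousLinearMap.compL ℝ E (E →L[ℝ] ℝ) E (G y).inverse ∘L christoffelLower G y

/-- The curvature `R(u, v) w = ∇ᵤ ∇ᵥ w - ∇ᵥ ∇ᵤ w` of constant (hence commuting) fields. -/
def curvature (G : E → E →L[ℝ] E →L[ℝ] ℝ) (y u v w : E) : E :=
  fderiv ℝ (christoffel G) y u v w + christoffel G y u (christoffel G y v w) -
    (fderiv ℝ (christoffel G) y v u w + christoffel G y v (christoffel G y u w))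

/-- The Ricci tensor `Ric(u, v)`, the trace of `e ↦ R(e, v) u`. -/
def ricci (G : E → E →L[ℝ] E →L[ℝ] ℝ) (y u v : E) : ℝ :=
  LinearMap.trace ℝ E
    { toFun := fun e ↦ curvature G y e v u
      map_add' := fun e e' ↦ by simp only [curvature, map_add, add_apply]; abel
      map_smul' := fun c e ↦ by
        simp only [curvature, map_smul, smul_apply, smul_add, smul_sub,
          RingHom.id_apply] }

/-- The Hessian `H^f(u, v) = u v f - (∇ᵤ v) f` for constant fields `u`, `v`. -/
def hessian (G : E → E →L[ℝ] E →L[ℝ] ℝ) (f : E → ℝ) (y : E) : E →L[ℝ] E →L[ℝ] ℝ :=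
  fderiv ℝ (fderiv ℝ f) y - ContinuousLinearMap.compL ℝ E E ℝ (fderiv ℝ f y) ∘L christoffel G y

theorem hessian_apply (G : E → E →L[ℝ] E →L[ℝ] ℝ) (f : E → ℝ) (y u v : E) :
    hessian G f y u v = fderiv ℝ (fderiv ℝ f) y u v - fderiv ℝ f y (christoffel G y u v) := rfl

/-- The Laplace-Beltrami operator `∇ⁱ ∇ᵢ f`, the metric trace of the Hessian. -/
def laplacian (G : E → E →L[ℝ] E →L[ℝ] ℝ) (f : E → ℝ) (y : E) : ℝ :=
  LinearMap.trace ℝ E ((G y).inverse ∘L hessian G f y : E →L[ℝ] E)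

end LocalMetric

namespace PseudoRiemannianMetric

section Operators

variable {E : Type*} [NormedAddCommGroup E] [NormedSpace ℝ E]
  {H : Type*} [TopologicalSpace H] {I : ModelWithCorners ℝ E H}
  {M : Type*} [TopologicalSpace M] [ChartedSpace H M] [IsManifold I ∞ M]

/-- The coordinate expression of the metric in the chart at `x₀`: the pull-back of `g` under the
inverse of the chart. (Meant for manifolds without boundary, where the domain of the inverse of the
chart is open in `E`.) -/
def inChart (g : PseudoRiemannianMetric I M) (x₀ : M) (y : E) : E →L[ℝ] E →L[ℝ] ℝ :=
  let A : E →L[ℝ] E := mfderiv 𝓘(ℝ, E) I (extChartAt I x₀).symm y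
  let B : E →L[ℝ] E →L[ℝ] ℝ := g.inner ((extChartAt I x₀).symm y)
  LocalMetric.pullback A B

/-- The Ricci tensor at `x`, computed in the chart at `x`. (By definition, the tangent space at `x`
is the model space `E`, a vector being identified with its coordinates in the chart at `x`.) -/
def ricci (g : PseudoRiemannianMetric I M) (x : M) (v w : TangentSpace I x) : ℝ :=
  LocalMetric.ricci (g.inChart x) (extChartAt I x x) v w

/-- The Hessian of the function `f` at `x`. -/
def hessian (g : PseudoRiemannianMetric I M) (f : M → ℝ) (x : M) (v w : TangentSpace I x) : ℝ :=
  LocalMetric.hessian (g.inChart x) (f ∘ (extChartAt I x).symm) (extChartAt I x x) v w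

/-- The Laplace-Beltrami operator applied to `f`, at `x`. -/
def laplacian (g : PseudoRiemannianMetric I M) (f : M → ℝ) (x : M) : ℝ :=
  LocalMetric.laplacian (g.inChart x) (f ∘ (extChartAt I x).symm) (extChartAt I x x)

theorem trivializationAt_bilin_apply {x₀ x : M} (hx : x ∈ (chartAt H x₀).source)
    (φ : TangentSpace I x →L[ℝ] TangentSpace I x →L[ℝ] ℝ) (u v : E) :
    (trivializationAt (E →L[ℝ] E →L[ℝ] ℝ)
      (fun x : M ↦ TangentSpace I x →L[ℝ] TangentSpace I x →L[ℝ] ℝ) x₀ ⟨x, φ⟩).2 u v =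
      φ (tangentCoordChange I x₀ x x u) (tangentCoordChange I x₀ x x v) := by
  have i1 := IsManifold.of_le (I := I) (M := M) (m := 1) (n := ∞) (by simp)
  have hs (u : E) : (trivializationAt E (fun x : M ↦ TangentSpace I x) x₀).symm x u =
      tangentCoordChange I x₀ x x u := by
    rw [← Trivialization.symmL_apply (R := ℝ) _ hx]
    exact congrArg (fun L : E →L[ℝ] E ↦ L u)
      (TangentBundle.symmL_trivializationAt_eq_core (I := I) hx)
  rw [hom_trivializationAt_apply]
  refine (inCoordinates_apply_eq₂ (F₁ := E) (F₂ := E) (F₃ := ℝ)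
    (E₁ := fun x : M ↦ TangentSpace I x) (E₂ := fun x : M ↦ TangentSpace I x)
    (E₃ := fun _ : M ↦ ℝ) (ϕ := φ) (v := u) (w := v) (x₀ := x₀) hx hx (Set.mem_univ _)).trans ?_
  rw [hs, hs]
  simp

end Operators

section Product

variable {E₁ : Type*} [NormedAddCommGroup E₁] [NormedSpace ℝ E₁]
  {H₁ : Type*} [TopologicalSpace H₁] {I₁ : ModelWithCorners ℝ E₁ H₁}
  {B : Type*} [TopologicalSpace B] [ChartedSpace H₁ B] [IsManifold I₁ ∞ B]
  {E₂ : Type*} [NormedAddCommGroup E₂] [NormedSpace ℝ E₂]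
  {H₂ : Type*} [TopologicalSpace H₂] {I₂ : ModelWithCorners ℝ E₂ H₂}
  {F : Type*} [TopologicalSpace F] [ChartedSpace H₂ F] [IsManifold I₂ ∞ F]

/-- The bilinear form `a² π^* g_B + b² σ^* g_F` on the tangent space to `B × F` at `z`. -/
def warpedForm (gB : PseudoRiemannianMetric I₁ B) (gF : PseudoRiemannianMetric I₂ F)
    (a b : ℝ) (z : B × F) :
    TangentSpace (I₁.prod I₂) z →L[ℝ] TangentSpace (I₁.prod I₂) z →L[ℝ] ℝ :=
  let P : E₁ × E₂ →L[ℝ] E₁ := mfderiv (I₁.prod I₂) I₁ Prod.fst z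
  let Q : E₁ × E₂ →L[ℝ] E₂ := mfderiv (I₁.prod I₂) I₂ Prod.snd z
  let GB : E₁ →L[ℝ] E₁ →L[ℝ] ℝ := gB.inner z.1
  let GF : E₂ →L[ℝ] E₂ →L[ℝ] ℝ := gF.inner z.2
  (a ^ 2 • LocalMetric.pullback P GB + b ^ 2 • LocalMetric.pullback Q GF :
    E₁ × E₂ →L[ℝ] E₁ × E₂ →L[ℝ] ℝ)

theorem warpedForm_apply (gB : PseudoRiemannianMetric I₁ B) (gF : PseudoRiemannianMetric I₂ F)
    (a b : ℝ) (z : B × F) (v w : TangentSpace (I₁.prod I₂) z) :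
    warpedForm gB gF a b z v w =
      a ^ 2 * gB.inner z.1 (v : E₁ × E₂).1 (w : E₁ × E₂).1 +
        b ^ 2 * gF.inner z.2 (v : E₁ × E₂).2 (w : E₁ × E₂).2 := by
  unfold warpedForm
  rw [mfderiv_fst, mfderiv_snd]
  rfl

theorem tangentCoordChange_prod {z₀ z : B × F} (hz : z ∈ (chartAt (ModelProd H₁ H₂) z₀).source) :
    tangentCoordChange (I₁.prod I₂) z₀ z z =
      (tangentCoordChange I₁ z₀.1 z.1 z.1).prodMap (tangentCoordChange I₂ z₀.2 z.2 z.2) := by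
  have h1 : z.1 ∈ (chartAt H₁ z₀.1).source := (by simpa using hz : _ ∧ _).1
  have h2 : z.2 ∈ (chartAt H₂ z₀.2).source := (by simpa using hz : _ ∧ _).2
  have k1 := hasFDerivWithinAt_tangentCoordChange (I := I₁) (x := z₀.1) (y := z.1) (z := z.1)
    (by simpa using h1)
  have k2 := hasFDerivWithinAt_tangentCoordChange (I := I₂) (x := z₀.2) (y := z.2) (z := z.2)
    (by simpa using h2)
  have k := hasFDerivWithinAt_tangentCoordChange (I := I₁.prod I₂) (x := z₀) (y := z) (z := z)
    (by simpa using hz)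
  have hr : Set.range (I₁.prod I₂) = Set.range I₁ ×ˢ Set.range I₂ := by
    rw [modelWithCorners_prod_coe, Set.range_prodMap]
  have hu : UniqueDiffWithinAt ℝ (Set.range (I₁.prod I₂)) (extChartAt (I₁.prod I₂) z₀ z) :=
    (I₁.prod I₂).uniqueDiffOn _ (Set.mem_range_self ((chartAt (ModelProd H₁ H₂) z₀) z))
  have k3 := HasFDerivWithinAt.prodMap (s := Set.range I₁ ×ˢ Set.range I₂)
    (p := (extChartAt I₁ z₀.1 z.1, extChartAt I₂ z₀.2 z.2))
    (k1.mono (Set.fst_image_prod_subset _ _)) (k2.mono (Set.snd_image_prod_subset _ _))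
  have hf : Prod.map (extChartAt I₁ z.1 ∘ (extChartAt I₁ z₀.1).symm)
      (extChartAt I₂ z.2 ∘ (extChartAt I₂ z₀.2).symm) =
      extChartAt (I₁.prod I₂) z ∘ (extChartAt (I₁.prod I₂) z₀).symm := by
    rw [extChartAt_prod, extChartAt_prod]
    rfl
  have hp : (extChartAt I₁ z₀.1 z.1, extChartAt I₂ z₀.2 z.2) = extChartAt (I₁.prod I₂) z₀ z := by
    rw [extChartAt_prod]
    rfl
  rw [hf, hp, ← hr] at k3
  exact hu.eq k k3

theorem contMDiff_warpedForm (gB : PseudoRiemannianMetric I₁ B) (gF : PseudoRiemannianMetric I₂ F)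
    {c w : B → ℝ} (hc : ContMDiff I₁ 𝓘(ℝ) ∞ c) (hw : ContMDiff I₁ 𝓘(ℝ) ∞ w) :
    ContMDiff (I₁.prod I₂) ((I₁.prod I₂).prod 𝓘(ℝ, E₁ × E₂ →L[ℝ] E₁ × E₂ →L[ℝ] ℝ)) ∞
      (fun z : B × F ↦ TotalSpace.mk' (E₁ × E₂ →L[ℝ] E₁ × E₂ →L[ℝ] ℝ)
        (E := fun z : B × F ↦
          TangentSpace (I₁.prod I₂) z →L[ℝ] TangentSpace (I₁.prod I₂) z →L[ℝ] ℝ)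
        z (warpedForm gB gF (c z.1) (w z.1) z)) := by
  intro z₀
  have hB := (contMDiffAt_section _).1 (gB.contMDiff z₀.1)
  have hF := (contMDiffAt_section _).1 (gF.contMDiff z₀.2)
  rw [contMDiffAt_section]
  have hB' := ((LocalMetric.pullback (ContinuousLinearMap.fst ℝ E₁ E₂)).contDiff.contMDiff
    (n := ∞)).contMDiffAt.comp z₀ (hB.comp z₀ (contMDiffAt_fst (I := I₁) (J := I₂)))
  have hF' := ((LocalMetric.pullback (ContinuousLinearMap.snd ℝ E₁ E₂)).contDiff.contMDiff
    (n := ∞)).contMDiffAt.comp z₀ (hF.comp z₀ (contMDiffAt_snd (I := I₁) (J := I₂)))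
  have hc' := ((hc z₀.1).comp z₀ (contMDiffAt_fst (I := I₁) (J := I₂))).pow 2
  have hw' := ((hw z₀.1).comp z₀ (contMDiffAt_fst (I := I₁) (J := I₂))).pow 2
  have key := (hc'.smul hB').add (hw'.smul hF')
  refine key.congr_of_eventuallyEq ?_
  filter_upwards [(chartAt (ModelProd H₁ H₂) z₀).open_source.mem_nhds
    (mem_chart_source (ModelProd H₁ H₂) z₀)] with z hz
  have h1 : z.1 ∈ (chartAt H₁ z₀.1).source := (by simpa using hz : _ ∧ _).1
  have h2 : z.2 ∈ (chartAt H₂ z₀.2).source := (by simpa using hz : _ ∧ _).2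
  refine ContinuousLinearMap.ext fun u ↦ ContinuousLinearMap.ext fun v ↦ ?_
  refine (trivializationAt_bilin_apply hz _ u v).trans ?_
  refine (warpedForm_apply gB gF _ _ z _ _).trans ?_
  have hu := DFunLike.congr_fun (tangentCoordChange_prod (I₁ := I₁) (I₂ := I₂) hz) u
  have hv := DFunLike.congr_fun (tangentCoordChange_prod (I₁ := I₁) (I₂ := I₂) hz) v
  refine (congrArg₂ (fun s t : E₁ × E₂ ↦ c z.1 ^ 2 * gB.inner z.1 s.1 t.1 +
    w z.1 ^ 2 * gF.inner z.2 s.2 t.2) hu hv).trans ?_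
  exact congrArg₂ (fun s t : ℝ ↦ c z.1 ^ 2 * s + w z.1 ^ 2 * t)
    (trivializationAt_bilin_apply h1 _ u.1 v.1).symm
    (trivializationAt_bilin_apply h2 _ u.2 v.2).symm

/-- The base conformal warped product: `B × F` with the metric `c² g_B ⊕ w² g_F`, that is,
`(c ∘ π)² π^* g_B + (w ∘ π)² σ^* g_F`. -/
def bcwp (gB : PseudoRiemannianMetric I₁ B) (gF : PseudoRiemannianMetric I₂ F) (c w : B → ℝ)
    (hc : ContMDiff I₁ 𝓘(ℝ) ∞ c) (hw : ContMDiff I₁ 𝓘(ℝ) ∞ w)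
    (hc_pos : ∀ p, 0 < c p) (hw_pos : ∀ p, 0 < w p) :
    PseudoRiemannianMetric (I₁.prod I₂) (B × F) where
  inner z := warpedForm gB gF (c z.1) (w z.1) z
  symm z u v := (warpedForm_apply gB gF _ _ z u v).trans
    ((congrArg₂ (fun s t : ℝ ↦ c z.1 ^ 2 * s + w z.1 ^ 2 * t) (gB.symm z.1 _ _)
      (gF.symm z.2 _ _)).trans (warpedForm_apply gB gF _ _ z v u).symm)
  nondegenerate z u hu := by
    let u₁ : TangentSpace I₁ z.1 := (u : E₁ × E₂).1
    let u₂ : TangentSpace I₂ z.2 := (u : E₁ × E₂).2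
    have key (x₁ : TangentSpace I₁ z.1) (x₂ : TangentSpace I₂ z.2) :
        c z.1 ^ 2 * gB.inner z.1 u₁ x₁ + w z.1 ^ 2 * gF.inner z.2 u₂ x₂ = 0 :=
      (warpedForm_apply gB gF (c z.1) (w z.1) z u ((x₁, x₂) : E₁ × E₂)).symm.trans (hu _)
    have h1 : u₁ = 0 := gB.nondegenerate z.1 u₁ fun x ↦ by
      simpa [(hc_pos z.1).ne'] using key x 0
    have h2 : u₂ = 0 := gF.nondegenerate z.2 u₂ fun x ↦ by
      simpa [(hw_pos z.1).ne'] using key 0 x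
    exact Prod.ext h1 h2
  contMDiff := contMDiff_warpedForm gB gF hc hw

theorem contMDiff_rpow_const {f : B → ℝ} (hf : ContMDiff I₁ 𝓘(ℝ) ∞ f) (hf_pos : ∀ p, 0 < f p)
    (t : ℝ) : ContMDiff I₁ 𝓘(ℝ) ∞ (fun p ↦ f p ^ t) := fun p ↦
  ((Real.contDiffAt_rpow_const_of_ne (p := t) (hf_pos p).ne').contMDiffAt (n := ∞)).comp p (hf p)

/-- The special base conformal warped product, or `(ψ, μ)`-bcwp: `B × F` with the metric
`ψ^(2μ) g_B + ψ² g_F`, i.e. the base conformal warped product with conformal factor `ψ^μ` and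
warping function `ψ`. -/
def sbcwp (gB : PseudoRiemannianMetric I₁ B) (gF : PseudoRiemannianMetric I₂ F) (ψ : B → ℝ)
    (hψ : ContMDiff I₁ 𝓘(ℝ) ∞ ψ) (hψ_pos : ∀ p, 0 < ψ p) (μ : ℝ) :
    PseudoRiemannianMetric (I₁.prod I₂) (B × F) :=
  bcwp gB gF (fun p ↦ ψ p ^ μ) ψ (contMDiff_rpow_const hψ hψ_pos μ) hψ
    (fun p ↦ Real.rpow_pos_of_pos (hψ_pos p) μ) hψ_pos

variable (I₁ I₂) in
/-- The lift to `(p, q)` of a vector tangent to the base at `p`. -/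
def liftBase (p : B) (q : F) (X : TangentSpace I₁ p) : TangentSpace (I₁.prod I₂) (p, q) :=
  ((X, 0) : E₁ × E₂)

variable (I₁ I₂) in
/-- The lift to `(p, q)` of a vector tangent to the fiber at `q`. -/
def liftFiber (p : B) (q : F) (V : TangentSpace I₂ q) : TangentSpace (I₁.prod I₂) (p, q) :=
  ((0, V) : E₁ × E₂)

theorem mfderiv_fst_liftBase (p : B) (q : F) (X : TangentSpace I₁ p) :
    mfderiv (I₁.prod I₂) I₁ Prod.fst (p, q) (liftBase I₁ I₂ p q X) = X := by
  rw [mfderiv_fst]; rfl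

theorem mfderiv_snd_liftBase (p : B) (q : F) (X : TangentSpace I₁ p) :
    mfderiv (I₁.prod I₂) I₂ Prod.snd (p, q) (liftBase I₁ I₂ p q X) = 0 := by
  rw [mfderiv_snd]; rfl

theorem mfderiv_fst_liftFiber (p : B) (q : F) (V : TangentSpace I₂ q) :
    mfderiv (I₁.prod I₂) I₁ Prod.fst (p, q) (liftFiber I₁ I₂ p q V) = 0 := by
  rw [mfderiv_fst]; rfl

theorem mfderiv_snd_liftFiber (p : B) (q : F) (V : TangentSpace I₂ q) :
    mfderiv (I₁.prod I₂) I₂ Prod.snd (p, q) (liftFiber I₁ I₂ p q V) = V := by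
  rw [mfderiv_snd]; rfl

end Product

end PseudoRiemannianMetric

end

section

open Filter Topology

namespace LocalMetric

section Basic

variable {E : Type*} [NormedAddCommGroup E] [NormedSpace ℝ E]

/-- `G` is, near `y`, the coordinate expression of a pseudo-Riemannian metric of class `C²`. -/
structure IsMetricAt (G : E → E →L[ℝ] E →L[ℝ] ℝ) (y : E) : Prop where
  contDiffAt : ContDiffAt ℝ 2 G y
  eventually_symm : ∀ᶠ z in 𝓝 y, ∀ u v, G z u v = G z v u
  eventually_isInvertible : ∀ᶠ z in 𝓝 y, (G z).IsInvertible

variable {G G' : E → E →L[ℝ] E →L[ℝ] ℝ} {f : E → ℝ} {y : E}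

namespace IsMetricAt

theorem symm (hG : IsMetricAt G y) (u v : E) : G y u v = G y v u :=
  hG.eventually_symm.self_of_nhds u v

theorem isInvertible (hG : IsMetricAt G y) : (G y).IsInvertible :=
  hG.eventually_isInvertible.self_of_nhds

theorem eventually (hG : IsMetricAt G y) : ∀ᶠ z in 𝓝 y, IsMetricAt G z := by
  filter_upwards [hG.contDiffAt.eventually (by simp), hG.eventually_symm.eventually_nhds,
    hG.eventually_isInvertible.eventually_nhds] with z h1 h2 h3
  exact ⟨h1, h2, h3⟩

theorem differentiableAt (hG : IsMetricAt G y) : DifferentiableAt ℝ G y :=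
  hG.contDiffAt.differentiableAt (by simp)

theorem ext_vec (hG : IsMetricAt G y) {a b : E} (h : ∀ w, G y a w = G y b w) : a = b :=
  hG.isInvertible.injective (ContinuousLinearMap.ext h)

theorem apply_inverse (hG : IsMetricAt G y) (ξ : E →L[ℝ] ℝ) (w : E) :
    G y ((G y).inverse ξ) w = ξ w := by
  rw [hG.isInvertible.self_apply_inverse]

theorem inverse_eq_of (hG : IsMetricAt G y) {ξ : E →L[ℝ] ℝ} {a : E}
    (h : ∀ w, G y a w = ξ w) : (G y).inverse ξ = a :=
  hG.ext_vec fun w ↦ by rw [hG.apply_inverse, h]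

theorem apply_christoffel (hG : IsMetricAt G y) (u v w : E) :
    G y (christoffel G y u v) w = christoffelLower G y u v w :=
  hG.apply_inverse _ w

theorem christoffel_eq_of (hG : IsMetricAt G y) {u v a : E}
    (h : ∀ w, G y a w = christoffelLower G y u v w) : christoffel G y u v = a :=
  hG.inverse_eq_of h

theorem fderiv_symm (hG : IsMetricAt G y) (e u v : E) :
    fderiv ℝ G y e u v = fderiv ℝ G y e v u := by
  have h1 : HasFDerivAt (fun z ↦ G z u v) _ y :=
    (hG.differentiableAt.hasFDerivAt.clm_apply (hasFDerivAt_const u y)).clm_apply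
      (hasFDerivAt_const v y)
  have h2 : HasFDerivAt (fun z ↦ G z v u) _ y :=
    (hG.differentiableAt.hasFDerivAt.clm_apply (hasFDerivAt_const v y)).clm_apply
      (hasFDerivAt_const u y)
  have h3 : (fun z ↦ G z u v) =ᶠ[𝓝 y] fun z ↦ G z v u := hG.eventually_symm.mono fun z h ↦ h u v
  simpa using congrArg (fun L : E →L[ℝ] ℝ ↦ L e) (h1.unique (h2.congr_of_eventuallyEq h3))

theorem christoffel_symm (hG : IsMetricAt G y) (u v : E) :
    christoffel G y u v = christoffel G y v u :=
  hG.christoffel_eq_of fun w ↦ by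
    rw [hG.apply_christoffel, christoffelLower_apply, christoffelLower_apply,
      hG.fderiv_symm w u v]
    ring

/-- The Levi-Civita connection is compatible with the metric. -/
theorem fderiv_apply_eq (hG : IsMetricAt G y) (e v w : E) :
    fderiv ℝ G y e v w = G y (christoffel G y e v) w + G y v (christoffel G y e w) := by
  rw [hG.symm v, hG.apply_christoffel, hG.apply_christoffel, christoffelLower_apply,
    christoffelLower_apply, hG.fderiv_symm e w v, hG.fderiv_symm w e v, hG.fderiv_symm v e w]
  ring

theorem contDiffAt_inverse [CompleteSpace E] (hG : IsMetricAt G y) :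
    ContDiffAt ℝ 2 (fun z ↦ (G z).inverse) y :=
  (hG.isInvertible.contDiffAt_map_inverse).comp y hG.contDiffAt

theorem differentiableAt_christoffel [CompleteSpace E] (hG : IsMetricAt G y) :
    DifferentiableAt ℝ (christoffel G) y := by
  have h1 : DifferentiableAt ℝ (fun z ↦ (G z).inverse) y :=
    hG.contDiffAt_inverse.differentiableAt (by simp)
  have h2 : DifferentiableAt ℝ (fderiv ℝ G) y :=
    (hG.contDiffAt.fderiv_right (m := 1) (by norm_num)).differentiableAt (by simp)
  have h3 : DifferentiableAt ℝ (fun z ↦ (fderiv ℝ G z).flip) y :=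
    (ContinuousLinearMap.flipₗᵢ ℝ E E (E →L[ℝ] ℝ)).toContinuousLinearEquiv.differentiableAt.comp
      y h2
  have h4 : DifferentiableAt ℝ (christoffelLower G) y := by
    unfold christoffelLower
    exact ((h2.add h3).sub ((differentiableAt_const _).clm_comp h3)).const_smul (1 / 2 : ℝ)
  unfold christoffel
  exact ((ContinuousLinearMap.compL ℝ E (E →L[ℝ] ℝ) E).differentiableAt.comp y h1).clm_comp h4

end IsMetricAt

theorem christoffelLower_congr (h : G =ᶠ[𝓝 y] G') :
    christoffelLower G y = christoffelLower G' y := by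
  unfold christoffelLower
  rw [h.fderiv_eq]

theorem christoffel_congr (h : G =ᶠ[𝓝 y] G') : christoffel G y = christoffel G' y := by
  unfold christoffel
  rw [christoffelLower_congr h, h.eq_of_nhds]

theorem christoffel_eventuallyEq (h : G =ᶠ[𝓝 y] G') : christoffel G =ᶠ[𝓝 y] christoffel G' := by
  filter_upwards [h.eventuallyEq_nhds] with z hz using christoffel_congr hz

theorem curvature_congr (h : G =ᶠ[𝓝 y] G') : curvature G y = curvature G' y := by
  ext u v w
  unfold curvature
  rw [christoffel_congr h, (christoffel_eventuallyEq h).fderiv_eq]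

theorem ricci_eq_trace {u v : E} {L : E →ₗ[ℝ] E} (h : ∀ e, L e = curvature G y e v u) :
    ricci G y u v = LinearMap.trace ℝ E L := by
  unfold ricci
  congr 1
  ext e
  exact (h e).symm

/-- The endomorphism `e ↦ R(e, v) u`, whose trace is `Ric(u, v)`. -/
noncomputable def curvatureEnd (G : E → E →L[ℝ] E →L[ℝ] ℝ) (y u v : E) : E →ₗ[ℝ] E where
  toFun e := curvature G y e v u
  map_add' e e' := by simp only [curvature, map_add, add_apply]; abel
  map_smul' c e := by
    simp only [curvature, map_smul, smul_apply, smul_add, smul_sub, RingHom.id_apply]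

theorem curvatureEnd_apply (u v e : E) : curvatureEnd G y u v e = curvature G y e v u := rfl

theorem ricci_congr (h : G =ᶠ[𝓝 y] G') : ricci G y = ricci G' y := by
  ext u v
  rw [ricci_eq_trace (curvatureEnd_apply u v), ricci_eq_trace fun e ↦ ?_]
  rw [curvatureEnd_apply, curvature_congr h]

/-- The gradient of `f` with respect to the metric `G`. -/
noncomputable def gradient (G : E → E →L[ℝ] E →L[ℝ] ℝ) (f : E → ℝ) (y : E) : E :=
  (G y).inverse (fderiv ℝ f y)

theorem IsMetricAt.apply_gradient (hG : IsMetricAt G y) (w : E) :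
    G y (gradient G f y) w = fderiv ℝ f y w :=
  hG.apply_inverse _ w

theorem IsMetricAt.hessian_symm (hG : IsMetricAt G y) (hf : ContDiffAt ℝ 2 f y) (u v : E) :
    hessian G f y u v = hessian G f y v u := by
  rw [hessian_apply, hessian_apply, hG.christoffel_symm u v,
    (hf.isSymmSndFDerivAt (by simp)).eq u v]

theorem IsMetricAt.contDiffAt_gradient [CompleteSpace E] (hG : IsMetricAt G y)
    (hf : ContDiffAt ℝ 2 f y) : ContDiffAt ℝ 1 (gradient G f) y :=
  (hG.contDiffAt_inverse.of_le (by norm_num)).clm_apply (hf.fderiv_right (by norm_num))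

/-- The covariant derivative of the gradient is the Hessian with an index raised. -/
theorem IsMetricAt.inverse_hessian [CompleteSpace E] (hG : IsMetricAt G y)
    (hf : ContDiffAt ℝ 2 f y) (e : E) :
    (G y).inverse (hessian G f y e) =
      fderiv ℝ (gradient G f) y e + christoffel G y e (gradient G f y) := by
  refine hG.inverse_eq_of fun w ↦ ?_
  have hN := ((hG.contDiffAt_gradient hf).differentiableAt (by simp)).hasFDerivAt
  have h1 : HasFDerivAt (fun z ↦ G z (gradient G f z) w) _ y :=
    (hG.differentiableAt.hasFDerivAt.clm_apply hN).clm_apply (hasFDerivAt_const w y)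
  have h2 : HasFDerivAt (fun z ↦ fderiv ℝ f z w) _ y :=
    ((hf.fderiv_right (m := 1) (by norm_num)).differentiableAt (by simp)).hasFDerivAt.clm_apply
      (hasFDerivAt_const w y)
  have h3 : (fun z ↦ G z (gradient G f z) w) =ᶠ[𝓝 y] fun z ↦ fderiv ℝ f z w :=
    hG.eventually.mono fun z h ↦ h.apply_gradient w
  have h4 := congrArg (fun L : E →L[ℝ] ℝ ↦ L e) (h1.unique (h2.congr_of_eventuallyEq h3))
  simp only [ContinuousLinearMap.comp_zero, zero_add, ContinuousLinearMap.flip_apply, add_apply,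
    ContinuousLinearMap.comp_apply, hG.fderiv_apply_eq] at h4
  rw [hessian_apply, map_add, add_apply, ← hG.apply_gradient (f := f) (christoffel G y e w)]
  linarith

end Basic

end LocalMetric

theorem _root_.HasFDerivAt.clm_apply_const {E F F' : Type*} [NormedAddCommGroup E]
    [NormedSpace ℝ E] [NormedAddCommGroup F] [NormedSpace ℝ F] [NormedAddCommGroup F']
    [NormedSpace ℝ F'] {L : E → F →L[ℝ] F'} {L' : E →L[ℝ] F →L[ℝ] F'} {y : E}
    (hL : HasFDerivAt L L' y) (u : F) : HasFDerivAt (fun z ↦ L z u) (L'.flip u) y := by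
  simpa using hL.clm_apply (hasFDerivAt_const u y)

namespace LocalMetric

section Conformal

variable {E : Type*} [NormedAddCommGroup E] [NormedSpace ℝ E] [CompleteSpace E]

/-- The conformally changed metric `e^(2f) G`. -/
noncomputable def conformal (f : E → ℝ) (G : E → E →L[ℝ] E →L[ℝ] ℝ) (y : E) :
    E →L[ℝ] E →L[ℝ] ℝ :=
  Real.exp (2 * f y) • G y

variable {G : E → E →L[ℝ] E →L[ℝ] ℝ} {f h : E → ℝ} {y : E}

theorem conformal_apply (u v : E) : conformal f G y u v = Real.exp (2 * f y) * G y u v := rfl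

namespace IsMetricAt

theorem conformal (hG : IsMetricAt G y) (hf : ContDiffAt ℝ 2 f y) :
    IsMetricAt (conformal f G) y where
  contDiffAt := ((contDiffAt_const.mul hf).exp).smul hG.contDiffAt
  eventually_symm := by
    filter_upwards [hG.eventually_symm] with z hz u v
    rw [conformal_apply, conformal_apply, hz]
  eventually_isInvertible := by
    filter_upwards [hG.eventually_isInvertible] with z hz
    obtain ⟨e, he⟩ := hz
    refine ⟨e.trans (ContinuousLinearEquiv.smulLeft
      (Units.mk0 (Real.exp (2 * f z)) (Real.exp_ne_zero _))), ?_⟩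
    ext u v
    rw [conformal_apply, ← he]
    rfl

theorem fderiv_conformal (hG : IsMetricAt G y) (hf : ContDiffAt ℝ 2 f y) (e u v : E) :
    fderiv ℝ (LocalMetric.conformal f G) y e u v =
      Real.exp (2 * f y) * (2 * fderiv ℝ f y e * G y u v + fderiv ℝ G y e u v) := by
  have h1 := ((hf.differentiableAt (by simp)).hasFDerivAt.const_mul 2).exp.smul
    hG.differentiableAt.hasFDerivAt
  have h2 : fderiv ℝ (LocalMetric.conformal f G) y = _ := h1.fderiv
  rw [h2]
  simp
  ring

theorem christoffel_conformal (hG : IsMetricAt G y) (hf : ContDiffAt ℝ 2 f y) (u v : E) :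
    christoffel (LocalMetric.conformal f G) y u v = christoffel G y u v +
      (fderiv ℝ f y u • v + fderiv ℝ f y v • u - G y u v • gradient G f y) := by
  refine (hG.conformal hf).christoffel_eq_of fun w ↦ ?_
  rw [conformal_apply, christoffelLower_apply]
  simp only [map_add, map_sub, map_smul, add_apply, sub_apply, smul_apply, smul_eq_mul,
    hG.fderiv_conformal hf, hG.apply_gradient, hG.apply_christoffel, christoffelLower_apply]
  ring

theorem fderiv_christoffel_conformal (hG : IsMetricAt G y) (hf : ContDiffAt ℝ 2 f y) (e u v : E) :
    fderiv ℝ (christoffel (LocalMetric.conformal f G)) y e u v =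
      fderiv ℝ (christoffel G) y e u v +
        (fderiv ℝ (fderiv ℝ f) y e u • v + fderiv ℝ (fderiv ℝ f) y e v • u -
          (fderiv ℝ G y e u v • gradient G f y + G y u v • fderiv ℝ (gradient G f) y e)) := by
  have hN := ((hG.contDiffAt_gradient hf).differentiableAt (by simp)).hasFDerivAt
  have hd := ((hf.fderiv_right (m := 1) (by norm_num)).differentiableAt (by simp)).hasFDerivAt
  have h1 := ((hG.conformal hf).differentiableAt_christoffel.hasFDerivAt.clm_apply_const
    u).clm_apply_const v
  have h2 := ((hG.differentiableAt_christoffel.hasFDerivAt.clm_apply_const u).clm_apply_const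
    v).add ((((hd.clm_apply_const u).smul_const v).add
      ((hd.clm_apply_const v).smul_const u)).sub
      (((hG.differentiableAt.hasFDerivAt.clm_apply_const u).clm_apply_const v).smul hN))
  have h3 : (fun z ↦ christoffel (LocalMetric.conformal f G) z u v) =ᶠ[𝓝 y] fun z ↦
      christoffel G z u v + (fderiv ℝ f z u • v + fderiv ℝ f z v • u -
        G z u v • gradient G f z) := by
    filter_upwards [hG.eventually, hf.eventually (by simp)] with z hz hfz
    exact hz.christoffel_conformal hfz u v
  have h4 := congrArg (fun L : E →L[ℝ] E ↦ L e) (h1.unique (h2.congr_of_eventuallyEq h3))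
  simp at h4
  rw [h4]
  abel

/-- The curvature of a conformally changed metric. -/
theorem curvature_conformal (hG : IsMetricAt G y) (hf : ContDiffAt ℝ 2 f y) (e v u : E) :
    curvature (LocalMetric.conformal f G) y e v u = curvature G y e v u +
      ((fderiv ℝ f y u * fderiv ℝ f y v - hessian G f y v u -
          fderiv ℝ f y (gradient G f y) * G y v u) • e +
        (hessian G f y e u - fderiv ℝ f y u * fderiv ℝ f y e +
          fderiv ℝ f y (gradient G f y) * G y e u) • v -
        G y v u • (G y).inverse (hessian G f y e) +
        G y e u • ((G y).inverse (hessian G f y v) - fderiv ℝ f y v • gradient G f y) +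
        (G y v u * fderiv ℝ f y e) • gradient G f y) := by
  rw [hG.inverse_hessian hf, hG.inverse_hessian hf]
  have hs : fderiv ℝ (fderiv ℝ f) y e v = fderiv ℝ (fderiv ℝ f) y v e :=
    (hf.isSymmSndFDerivAt (by simp)).eq e v
  have hc := hG.christoffel_symm e v
  simp only [curvature, hG.fderiv_christoffel_conformal hf, hG.christoffel_conformal hf,
    hessian_apply, map_add, map_sub, map_smul, smul_eq_mul,
    hG.apply_gradient, hG.fderiv_apply_eq, hs, hc, hG.symm v e, hG.symm _ (gradient G f y)]
  rw [hG.symm v (christoffel G y e u), hG.symm e (christoffel G y v u)]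
  module

/-- The Ricci tensor of a conformally changed metric. -/
theorem ricci_conformal [FiniteDimensional ℝ E] (hG : IsMetricAt G y) (hf : ContDiffAt ℝ 2 f y)
    (u v : E) :
    ricci (LocalMetric.conformal f G) y u v = ricci G y u v -
      ((finrank ℝ E : ℝ) - 2) * (hessian G f y u v - fderiv ℝ f y u * fderiv ℝ f y v) -
      (laplacian G f y + ((finrank ℝ E : ℝ) - 2) * fderiv ℝ f y (gradient G f y)) * G y u v := by
  let φ : E →ₗ[ℝ] ℝ := (fderiv ℝ f y : E →L[ℝ] ℝ)
  let A : E →ₗ[ℝ] E := ((G y).inverse ∘L hessian G f y : E →L[ℝ] E)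
  let Hu : E →ₗ[ℝ] ℝ := ((hessian G f y).flip u : E →L[ℝ] ℝ)
  let Gu : E →ₗ[ℝ] ℝ := ((G y).flip u : E →L[ℝ] ℝ)
  have key := ricci_eq_trace (G := LocalMetric.conformal f G) (y := y) (u := u) (v := v)
    (L := curvatureEnd G y u v +
      ((fderiv ℝ f y u * fderiv ℝ f y v - hessian G f y v u -
          fderiv ℝ f y (gradient G f y) * G y v u) • LinearMap.id +
        (Hu - fderiv ℝ f y u • φ + fderiv ℝ f y (gradient G f y) • Gu).smulRight v -
        G y v u • A +
        Gu.smulRight ((G y).inverse (hessian G f y v) - fderiv ℝ f y v • gradient G f y) +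
        (G y v u • φ).smulRight (gradient G f y)))
    fun e ↦ (hG.curvature_conformal hf e v u).symm
  rw [key]
  simp only [map_add, map_sub, map_smul, LinearMap.trace_id, LinearMap.trace_smulRight,
    ← ricci_eq_trace (curvatureEnd_apply u v), LinearMap.add_apply, LinearMap.sub_apply,
    LinearMap.smul_apply, smul_eq_mul]
  have e1 : LinearMap.trace ℝ E A = laplacian G f y := rfl
  have e2 (x : E) : φ x = fderiv ℝ f y x := rfl
  have e3 (x : E) : Hu x = hessian G f y x u := rfl
  have e4 (x : E) : Gu x = G y x u := rfl
  simp only [e1, e2, e3, e4, hG.apply_gradient, hG.apply_inverse, hG.symm v u,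
    hG.hessian_symm hf v u]
  ring

theorem gradient_conformal (hG : IsMetricAt G y) (hf : ContDiffAt ℝ 2 f y) :
    gradient (LocalMetric.conformal f G) h y = (Real.exp (2 * f y))⁻¹ • gradient G h y := by
  refine (hG.conformal hf).inverse_eq_of fun w ↦ ?_
  rw [conformal_apply, map_smul, smul_apply, hG.apply_gradient, smul_eq_mul,
    mul_inv_cancel_left₀ (Real.exp_ne_zero _)]

theorem hessian_conformal (hG : IsMetricAt G y) (hf : ContDiffAt ℝ 2 f y) (u v : E) :
    hessian (LocalMetric.conformal f G) h y u v = hessian G h y u v -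
      (fderiv ℝ f y u * fderiv ℝ h y v + fderiv ℝ f y v * fderiv ℝ h y u -
        G y u v * fderiv ℝ h y (gradient G f y)) := by
  simp only [hessian_apply, hG.christoffel_conformal hf, map_add, map_sub, map_smul, smul_eq_mul]
  ring

theorem laplacian_conformal [FiniteDimensional ℝ E] (hG : IsMetricAt G y)
    (hf : ContDiffAt ℝ 2 f y) :
    laplacian (LocalMetric.conformal f G) h y = (Real.exp (2 * f y))⁻¹ *
      (laplacian G h y + ((finrank ℝ E : ℝ) - 2) * fderiv ℝ h y (gradient G f y)) := by
  let A : E →ₗ[ℝ] E := ((G y).inverse ∘L hessian G h y : E →L[ℝ] E)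
  let φ : E →ₗ[ℝ] ℝ := (fderiv ℝ f y : E →L[ℝ] ℝ)
  let χ : E →ₗ[ℝ] ℝ := (fderiv ℝ h y : E →L[ℝ] ℝ)
  have key : (((LocalMetric.conformal f G y).inverse ∘L
      hessian (LocalMetric.conformal f G) h y : E →L[ℝ] E) : E →ₗ[ℝ] E) =
      (Real.exp (2 * f y))⁻¹ • (A - (φ.smulRight (gradient G h y) +
        χ.smulRight (gradient G f y) - fderiv ℝ h y (gradient G f y) • LinearMap.id)) := by
    ext e
    refine (hG.conformal hf).inverse_eq_of fun w ↦ ?_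
    have e1 : A e = (G y).inverse (hessian G h y e) := rfl
    have e2 : φ e = fderiv ℝ f y e := rfl
    have e3 : χ e = fderiv ℝ h y e := rfl
    rw [ContinuousLinearMap.coe_coe, hG.hessian_conformal hf]
    simp only [conformal_apply, LinearMap.smul_apply, LinearMap.sub_apply, LinearMap.add_apply,
      smul_apply, sub_apply, add_apply, LinearMap.smulRight_apply, map_smul, map_sub, map_add, LinearMap.id_apply,
      e1, e2, e3, hG.apply_inverse, hG.apply_gradient, smul_eq_mul]
    field_simp [Real.exp_ne_zero]
  have e1 : LinearMap.trace ℝ E A = laplacian G h y := rfl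
  have e2 (x : E) : φ x = fderiv ℝ f y x := rfl
  have e3 (x : E) : χ x = fderiv ℝ h y x := rfl
  have e4 : fderiv ℝ f y (gradient G h y) = fderiv ℝ h y (gradient G f y) := by
    rw [← hG.apply_gradient, ← hG.apply_gradient, hG.symm]
  unfold laplacian
  rw [key]
  simp only [map_add, map_sub, map_smul, LinearMap.trace_id, LinearMap.trace_smulRight, e1, e2,
    e3, e4, smul_eq_mul]
  unfold laplacian
  ring

end IsMetricAt

end Conformal

section Functions

variable {E : Type*} [NormedAddCommGroup E] [NormedSpace ℝ E]
  {G : E → E →L[ℝ] E →L[ℝ] ℝ} {f : E → ℝ} {y : E}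

theorem fderiv_const_mul (hf : ContDiffAt ℝ 2 f y) (t : ℝ) :
    fderiv ℝ (fun z ↦ t * f z) y = t • fderiv ℝ f y :=
  ((hf.differentiableAt (by simp)).hasFDerivAt.const_mul t).fderiv

theorem gradient_const_mul (hf : ContDiffAt ℝ 2 f y) (t : ℝ) :
    gradient G (fun z ↦ t * f z) y = t • gradient G f y := by
  rw [gradient, fderiv_const_mul hf, map_smul, gradient]

theorem hessian_const_mul (hf : ContDiffAt ℝ 2 f y) (t : ℝ) :
    hessian G (fun z ↦ t * f z) y = t • hessian G f y := by
  have h1 : fderiv ℝ (fun z ↦ t * f z) =ᶠ[𝓝 y] fun z ↦ t • fderiv ℝ f z :=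
    (hf.eventually (by simp)).mono fun z hz ↦ fderiv_const_mul hz t
  have h2 := ((hf.fderiv_right (m := 1) (by norm_num)).differentiableAt
    (by simp)).hasFDerivAt.const_smul t
  ext u v
  rw [hessian_apply, h1.fderiv_eq, h1.eq_of_nhds]
  have h3 : fderiv ℝ (fun z ↦ t • fderiv ℝ f z) y = _ := h2.fderiv
  rw [h3]
  simp only [smul_apply, hessian_apply, smul_eq_mul]
  ring

theorem laplacian_const_mul (hf : ContDiffAt ℝ 2 f y) (t : ℝ) :
    laplacian G (fun z ↦ t * f z) y = t * laplacian G f y := by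
  unfold laplacian
  rw [hessian_const_mul hf, ContinuousLinearMap.comp_smul, ContinuousLinearMap.toLinearMap_smul,
    map_smul, smul_eq_mul]

theorem fderiv_exp_mul (hf : ContDiffAt ℝ 2 f y) (t : ℝ) :
    fderiv ℝ (fun z ↦ Real.exp (t * f z)) y = Real.exp (t * f y) • t • fderiv ℝ f y :=
  ((hf.differentiableAt (by simp)).hasFDerivAt.const_mul t).exp.fderiv

theorem hessian_exp_mul (hf : ContDiffAt ℝ 2 f y) (t : ℝ) :
    hessian G (fun z ↦ Real.exp (t * f z)) y = Real.exp (t * f y) • (t • hessian G f y +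
      t ^ 2 • (fderiv ℝ f y).smulRight (fderiv ℝ f y)) := by
  have h1 : fderiv ℝ (fun z ↦ Real.exp (t * f z)) =ᶠ[𝓝 y]
      fun z ↦ Real.exp (t * f z) • t • fderiv ℝ f z :=
    (hf.eventually (by simp)).mono fun z hz ↦ fderiv_exp_mul hz t
  have h2 := ((hf.fderiv_right (m := 1) (by norm_num)).differentiableAt
    (by simp)).hasFDerivAt.const_smul t
  have h3 : fderiv ℝ (fun z ↦ Real.exp (t * f z) • t • fderiv ℝ f z) y = _ :=
    (((hf.differentiableAt (by simp)).hasFDerivAt.const_mul t).exp.smul h2).fderiv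
  ext u v
  rw [hessian_apply, h1.fderiv_eq, h1.eq_of_nhds, h3]
  simp [hessian_apply]
  ring

theorem laplacian_exp_mul [FiniteDimensional ℝ E] (hf : ContDiffAt ℝ 2 f y) (t : ℝ) :
    laplacian G (fun z ↦ Real.exp (t * f z)) y = Real.exp (t * f y) *
      (t * laplacian G f y + t ^ 2 * fderiv ℝ f y (gradient G f y)) := by
  let φ : E →ₗ[ℝ] ℝ := (fderiv ℝ f y : E →L[ℝ] ℝ)
  let A : E →ₗ[ℝ] E := ((G y).inverse ∘L hessian G f y : E →L[ℝ] E)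
  have key : (((G y).inverse ∘L hessian G (fun z ↦ Real.exp (t * f z)) y : E →L[ℝ] E) :
      E →ₗ[ℝ] E) = Real.exp (t * f y) • (t • A + t ^ 2 • φ.smulRight (gradient G f y)) := by
    rw [hessian_exp_mul hf]
    ext e
    simp [A, φ, gradient]
  have e1 : LinearMap.trace ℝ E A = laplacian G f y := rfl
  have e2 (x : E) : φ x = fderiv ℝ f y x := rfl
  rw [laplacian, key]
  simp only [map_add, map_smul, LinearMap.trace_smulRight, e1, e2, smul_eq_mul]

end Functions

end LocalMetric

namespace LocalMetric

theorem isInvertible_of_nondegenerate {E : Type*} [NormedAddCommGroup E] [NormedSpace ℝ E]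
    [FiniteDimensional ℝ E] {φ : E →L[ℝ] E →L[ℝ] ℝ} (h : ∀ v, (∀ w, φ v w = 0) → v = 0) :
    φ.IsInvertible := by
  have hi : Function.Injective (φ : E →ₗ[ℝ] E →L[ℝ] ℝ) :=
    (injective_iff_map_eq_zero _).2 fun v hv ↦ h v fun w ↦ DFunLike.congr_fun hv w
  have hd : finrank ℝ E = finrank ℝ (E →L[ℝ] ℝ) := by
    rw [← (LinearMap.toContinuousLinearMap : (E →ₗ[ℝ] ℝ) ≃ₗ[ℝ] E →L[ℝ] ℝ).finrank_eq]
    exact (Subspace.dual_finrank_eq (K := ℝ) (V := E)).symm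
  exact ⟨(LinearEquiv.ofInjectiveOfFinrankEq _ hi hd).toContinuousLinearEquiv, by ext; rfl⟩

section Product

variable {E₁ : Type*} [NormedAddCommGroup E₁] [NormedSpace ℝ E₁] [FiniteDimensional ℝ E₁]
  {E₂ : Type*} [NormedAddCommGroup E₂] [NormedSpace ℝ E₂] [FiniteDimensional ℝ E₂]

/-- The product metric `G₁ ⊕ G₂`. -/
noncomputable def prodMetric (G₁ : E₁ → E₁ →L[ℝ] E₁ →L[ℝ] ℝ)
    (G₂ : E₂ → E₂ →L[ℝ] E₂ →L[ℝ] ℝ) (y : E₁ × E₂) :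
    E₁ × E₂ →L[ℝ] E₁ × E₂ →L[ℝ] ℝ :=
  pullback (ContinuousLinearMap.fst ℝ E₁ E₂) (G₁ y.1) +
    pullback (ContinuousLinearMap.snd ℝ E₁ E₂) (G₂ y.2)

variable {G₁ : E₁ → E₁ →L[ℝ] E₁ →L[ℝ] ℝ} {G₂ : E₂ → E₂ →L[ℝ] E₂ →L[ℝ] ℝ} {y : E₁ × E₂}
  {f : E₁ → ℝ}

theorem prodMetric_apply (u v : E₁ × E₂) :
    prodMetric G₁ G₂ y u v = G₁ y.1 u.1 v.1 + G₂ y.2 u.2 v.2 := rfl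

theorem IsMetricAt.prod (h₁ : IsMetricAt G₁ y.1) (h₂ : IsMetricAt G₂ y.2) :
    IsMetricAt (prodMetric G₁ G₂) y where
  contDiffAt :=
    ((pullback (ContinuousLinearMap.fst ℝ E₁ E₂)).contDiff.contDiffAt.comp y
      (h₁.contDiffAt.comp y contDiffAt_fst)).add
    ((pullback (ContinuousLinearMap.snd ℝ E₁ E₂)).contDiff.contDiffAt.comp y
      (h₂.contDiffAt.comp y contDiffAt_snd))
  eventually_symm := by
    filter_upwards [continuousAt_fst.eventually h₁.eventually_symm,
      continuousAt_snd.eventually h₂.eventually_symm] with z hz₁ hz₂ u v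
    rw [prodMetric_apply, prodMetric_apply, hz₁, hz₂]
  eventually_isInvertible := by
    filter_upwards [continuousAt_fst.eventually h₁.eventually_isInvertible,
      continuousAt_snd.eventually h₂.eventually_isInvertible] with z hz₁ hz₂
    refine isInvertible_of_nondegenerate fun v hv ↦ Prod.ext ?_ ?_
    · refine hz₁.injective (ContinuousLinearMap.ext fun w ↦ ?_)
      simpa [prodMetric_apply] using hv (w, 0)
    · refine hz₂.injective (ContinuousLinearMap.ext fun w ↦ ?_)
      simpa [prodMetric_apply] using hv (0, w)

theorem fderiv_prodMetric (h₁ : IsMetricAt G₁ y.1) (h₂ : IsMetricAt G₂ y.2) (e u v : E₁ × E₂) :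
    fderiv ℝ (prodMetric G₁ G₂) y e u v =
      fderiv ℝ G₁ y.1 e.1 u.1 v.1 + fderiv ℝ G₂ y.2 e.2 u.2 v.2 := by
  have k : HasFDerivAt (prodMetric G₁ G₂) _ y :=
    ((pullback (ContinuousLinearMap.fst ℝ E₁ E₂)).hasFDerivAt.comp y
      (h₁.differentiableAt.hasFDerivAt.comp y hasFDerivAt_fst)).add
    ((pullback (ContinuousLinearMap.snd ℝ E₁ E₂)).hasFDerivAt.comp y
      (h₂.differentiableAt.hasFDerivAt.comp y hasFDerivAt_snd))
  rw [k.fderiv]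
  rfl

theorem christoffel_prodMetric (h₁ : IsMetricAt G₁ y.1) (h₂ : IsMetricAt G₂ y.2)
    (u v : E₁ × E₂) :
    christoffel (prodMetric G₁ G₂) y u v =
      (christoffel G₁ y.1 u.1 v.1, christoffel G₂ y.2 u.2 v.2) := by
  refine (h₁.prod h₂).christoffel_eq_of fun w ↦ ?_
  rw [prodMetric_apply, h₁.apply_christoffel, h₂.apply_christoffel]
  simp only [christoffelLower_apply, fderiv_prodMetric h₁ h₂]
  ring

theorem fderiv_christoffel_prodMetric (h₁ : IsMetricAt G₁ y.1) (h₂ : IsMetricAt G₂ y.2)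
    (e u v : E₁ × E₂) :
    fderiv ℝ (christoffel (prodMetric G₁ G₂)) y e u v =
      (fderiv ℝ (christoffel G₁) y.1 e.1 u.1 v.1, fderiv ℝ (christoffel G₂) y.2 e.2 u.2 v.2) := by
  have k1 := ((h₁.prod h₂).differentiableAt_christoffel.hasFDerivAt.clm_apply_const
    u).clm_apply_const v
  have k2 := (((h₁.differentiableAt_christoffel.hasFDerivAt.clm_apply_const
      u.1).clm_apply_const v.1).comp y hasFDerivAt_fst).prodMk
    (((h₂.differentiableAt_christoffel.hasFDerivAt.clm_apply_const
      u.2).clm_apply_const v.2).comp y hasFDerivAt_snd)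
  have k3 : (fun z ↦ christoffel (prodMetric G₁ G₂) z u v) =ᶠ[𝓝 y] fun z ↦
      (christoffel G₁ z.1 u.1 v.1, christoffel G₂ z.2 u.2 v.2) := by
    filter_upwards [continuousAt_fst.eventually h₁.eventually,
      continuousAt_snd.eventually h₂.eventually] with z hz₁ hz₂
    exact christoffel_prodMetric hz₁ hz₂ u v
  exact congrArg (fun L : E₁ × E₂ →L[ℝ] E₁ × E₂ ↦ L e)
    (k1.unique (k2.congr_of_eventuallyEq k3))

theorem curvature_prodMetric (h₁ : IsMetricAt G₁ y.1) (h₂ : IsMetricAt G₂ y.2)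
    (u v w : E₁ × E₂) :
    curvature (prodMetric G₁ G₂) y u v w =
      (curvature G₁ y.1 u.1 v.1 w.1, curvature G₂ y.2 u.2 v.2 w.2) := by
  simp only [curvature, fderiv_christoffel_prodMetric h₁ h₂, christoffel_prodMetric h₁ h₂]
  rfl

theorem ricci_prodMetric (h₁ : IsMetricAt G₁ y.1) (h₂ : IsMetricAt G₂ y.2) (u v : E₁ × E₂) :
    ricci (prodMetric G₁ G₂) y u v = ricci G₁ y.1 u.1 v.1 + ricci G₂ y.2 u.2 v.2 := by
  rw [ricci_eq_trace (curvatureEnd_apply u.1 v.1), ricci_eq_trace (curvatureEnd_apply u.2 v.2),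
    ← LinearMap.trace_prodMap']
  exact ricci_eq_trace fun e ↦ (curvature_prodMetric h₁ h₂ e v u).symm

theorem fderiv_comp_fst (hf : ContDiffAt ℝ 2 f y.1) :
    fderiv ℝ (fun z : E₁ × E₂ ↦ f z.1) y =
      (fderiv ℝ f y.1).comp (ContinuousLinearMap.fst ℝ E₁ E₂) :=
  ((hf.differentiableAt (by simp)).hasFDerivAt.comp y hasFDerivAt_fst).fderiv

theorem gradient_prodMetric (h₁ : IsMetricAt G₁ y.1) (h₂ : IsMetricAt G₂ y.2)
    (hf : ContDiffAt ℝ 2 f y.1) :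
    gradient (prodMetric G₁ G₂) (fun z ↦ f z.1) y = (gradient G₁ f y.1, 0) := by
  refine (h₁.prod h₂).inverse_eq_of fun w ↦ ?_
  rw [prodMetric_apply, h₁.apply_gradient, fderiv_comp_fst hf]
  simp

theorem hessian_prodMetric (h₁ : IsMetricAt G₁ y.1) (h₂ : IsMetricAt G₂ y.2)
    (hf : ContDiffAt ℝ 2 f y.1) (u v : E₁ × E₂) :
    hessian (prodMetric G₁ G₂) (fun z ↦ f z.1) y u v = hessian G₁ f y.1 u.1 v.1 := by
  have k1 : fderiv ℝ (fun z : E₁ × E₂ ↦ f z.1) =ᶠ[𝓝 y]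
      fun z ↦ (fderiv ℝ f z.1).comp (ContinuousLinearMap.fst ℝ E₁ E₂) :=
    (continuousAt_fst.eventually (hf.eventually (by simp))).mono fun z hz ↦ fderiv_comp_fst hz
  have k2 := (((hf.fderiv_right (m := 1) (by norm_num)).differentiableAt
    (by simp)).hasFDerivAt.comp y hasFDerivAt_fst).clm_comp
      (hasFDerivAt_const (ContinuousLinearMap.fst ℝ E₁ E₂) y)
  have k3 : fderiv ℝ (fun z : E₁ × E₂ ↦
    (fderiv ℝ f z.1).comp (ContinuousLinearMap.fst ℝ E₁ E₂)) y = _ := k2.fderiv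
  rw [hessian_apply, k1.fderiv_eq, k3, fderiv_comp_fst hf, christoffel_prodMetric h₁ h₂]
  simp [hessian_apply]

theorem laplacian_prodMetric (h₁ : IsMetricAt G₁ y.1) (h₂ : IsMetricAt G₂ y.2)
    (hf : ContDiffAt ℝ 2 f y.1) :
    laplacian (prodMetric G₁ G₂) (fun z ↦ f z.1) y = laplacian G₁ f y.1 := by
  let A : E₁ →ₗ[ℝ] E₁ := ((G₁ y.1).inverse ∘L hessian G₁ f y.1 : E₁ →L[ℝ] E₁)
  have key : (((prodMetric G₁ G₂ y).inverse ∘L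
      hessian (prodMetric G₁ G₂) (fun z ↦ f z.1) y : E₁ × E₂ →L[ℝ] E₁ × E₂) :
      E₁ × E₂ →ₗ[ℝ] E₁ × E₂) = A.prodMap 0 := by
    refine LinearMap.ext fun e ↦ (h₁.prod h₂).inverse_eq_of fun w ↦ ?_
    have e1 : A e.1 = (G₁ y.1).inverse (hessian G₁ f y.1 e.1) := rfl
    rw [ContinuousLinearMap.coe_coe, hessian_prodMetric h₁ h₂ hf, prodMetric_apply,
      LinearMap.prodMap_apply, e1, h₁.apply_inverse]
    simp
  rw [laplacian, key, LinearMap.trace_prodMap', map_zero, add_zero]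
  rfl

/-- The metric `e^(2μf) G₁ ⊕ e^(2f) G₂`, as a conformal change of a product. -/
noncomputable def warped (f : E₁ → ℝ) (μ : ℝ) (G₁ : E₁ → E₁ →L[ℝ] E₁ →L[ℝ] ℝ)
    (G₂ : E₂ → E₂ →L[ℝ] E₂ →L[ℝ] ℝ) : E₁ × E₂ → E₁ × E₂ →L[ℝ] E₁ × E₂ →L[ℝ] ℝ :=
  conformal (fun z ↦ f z.1) (prodMetric (conformal (fun x ↦ (μ - 1) * f x) G₁) G₂)

theorem warped_apply (μ : ℝ) (u v : E₁ × E₂) :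
    warped f μ G₁ G₂ y u v =
      Real.exp (μ * f y.1) ^ 2 * G₁ y.1 u.1 v.1 + Real.exp (f y.1) ^ 2 * G₂ y.2 u.2 v.2 := by
  rw [warped, conformal_apply, prodMetric_apply, conformal_apply, mul_add, ← mul_assoc,
    ← Real.exp_add, ← Real.exp_nat_mul, ← Real.exp_nat_mul]
  congr 4
  push_cast
  ring

/-- The Ricci tensor of `e^(2μf) G₁ ⊕ e^(2f) G₂`. -/
theorem ricci_warped (h₁ : IsMetricAt G₁ y.1) (h₂ : IsMetricAt G₂ y.2)
    (hf : ContDiffAt ℝ 2 f y.1) {μ D : ℝ}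
    (hD : D = ((finrank ℝ E₁ : ℝ) - 2) * μ + finrank ℝ E₂) (u v : E₁ × E₂) :
    ricci (warped f μ G₁ G₂) y u v = ricci G₁ y.1 u.1 v.1 + ricci G₂ y.2 u.2 v.2 -
      D * hessian G₁ f y.1 u.1 v.1 +
      (μ * D + finrank ℝ E₂ * (μ - 1)) * (fderiv ℝ f y.1 u.1 * fderiv ℝ f y.1 v.1) -
      (laplacian G₁ f y.1 + D * fderiv ℝ f y.1 (gradient G₁ f y.1)) *
        (μ * G₁ y.1 u.1 v.1 + (Real.exp (2 * ((μ - 1) * f y.1)))⁻¹ * G₂ y.2 u.2 v.2) := by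
  have hc : ContDiffAt ℝ 2 (fun x ↦ (μ - 1) * f x) y.1 := contDiffAt_const.mul hf
  have k₁ := h₁.conformal hc
  have hf' : ContDiffAt ℝ 2 (fun z : E₁ × E₂ ↦ f z.1) y := hf.comp y contDiffAt_fst
  rw [warped, (k₁.prod h₂).ricci_conformal hf', ricci_prodMetric k₁ h₂, hessian_prodMetric k₁ h₂ hf,
    laplacian_prodMetric k₁ h₂ hf, gradient_prodMetric k₁ h₂ hf, h₁.ricci_conformal hc,
    h₁.hessian_conformal hc, h₁.laplacian_conformal hc, h₁.gradient_conformal hc,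
    prodMetric_apply, conformal_apply, hessian_const_mul hf, laplacian_const_mul hf,
    gradient_const_mul hf, fderiv_const_mul hf, fderiv_comp_fst hf, finrank_prod, hD]
  simp only [ContinuousLinearMap.comp_apply, ContinuousLinearMap.coe_fst', smul_apply, map_smul,
    smul_eq_mul]
  push_cast
  field_simp [Real.exp_ne_zero]
  ring

end Product

end LocalMetric

namespace PseudoRiemannianMetric

section Chart

variable {E : Type*} [NormedAddCommGroup E] [NormedSpace ℝ E]
  {H : Type*} [TopologicalSpace H] {I : ModelWithCorners ℝ E H} [I.Boundaryless]
  {M : Type*} [TopologicalSpace M] [ChartedSpace H M] [IsManifold I ∞ M]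

theorem mfderiv_extChartAt_symm_eq_tangentCoordChange {x₀ : M} {y : E}
    (hy : y ∈ (extChartAt I x₀).target) :
    (mfderiv 𝓘(ℝ, E) I (extChartAt I x₀).symm y : E →L[ℝ] E) =
      tangentCoordChange I x₀ ((extChartAt I x₀).symm y) ((extChartAt I x₀).symm y) := by
  have i1 := IsManifold.of_le (I := I) (M := M) (m := 1) (n := ∞) (by simp)
  have hx : (extChartAt I x₀).symm y ∈ (chartAt H x₀).source := by
    simpa using (extChartAt I x₀).map_target hy
  have h1 := TangentBundle.symmL_trivializationAt (I := I) hx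
  rw [TangentBundle.symmL_trivializationAt_eq_core hx, (extChartAt I x₀).right_inv hy,
    I.range_eq_univ, mfderivWithin_univ] at h1
  exact h1.symm

theorem inChart_apply (g : PseudoRiemannianMetric I M) {x₀ : M} {y : E}
    (hy : y ∈ (extChartAt I x₀).target) (u v : E) :
    g.inChart x₀ y u v = g.inner ((extChartAt I x₀).symm y)
      (tangentCoordChange I x₀ ((extChartAt I x₀).symm y) ((extChartAt I x₀).symm y) u)
      (tangentCoordChange I x₀ ((extChartAt I x₀).symm y) ((extChartAt I x₀).symm y) v) := by
  unfold inChart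
  refine (LocalMetric.pullback_apply _ _ u v).trans ?_
  rw [mfderiv_extChartAt_symm_eq_tangentCoordChange hy]
  rfl

/-- In the chart at `x`, the metric at `x` itself is `g.inner x`. -/
theorem inChart_self (g : PseudoRiemannianMetric I M) (x : M) (u v : E) :
    g.inChart x (extChartAt I x x) u v = g.inner x u v := by
  have key : ∀ x' : M, x' = x → ∀ a b : E,
      a = tangentCoordChange I x x' x' u → b = tangentCoordChange I x x' x' v →
      g.inner x' a b = g.inner x u v := by
    rintro x' rfl a b rfl rfl
    rw [tangentCoordChange_self (by simp), tangentCoordChange_self (by simp)]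
  rw [inChart_apply g (mem_extChartAt_target x)]
  exact key _ (extChartAt_to_inv x) _ _ rfl rfl

theorem isMetricAt_inChart [FiniteDimensional ℝ E] (g : PseudoRiemannianMetric I M) (x₀ : M) :
    LocalMetric.IsMetricAt (g.inChart x₀) (extChartAt I x₀ x₀) where
  contDiffAt := by
    have h1 := (contMDiffAt_section _).1 (g.contMDiff x₀)
    have h2 : ContMDiffAt 𝓘(ℝ, E) I ∞ (extChartAt I x₀).symm (extChartAt I x₀ x₀) :=
      (contMDiffOn_extChartAt_symm x₀).contMDiffAt (extChartAt_target_mem_nhds x₀)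
    have h3 := (ContMDiffAt.comp_of_eq h1 h2 (extChartAt_to_inv x₀)).contDiffAt
    refine (h3.of_le (WithTop.coe_le_coe.2 (le_top : (2 : ℕ∞) ≤ ⊤))).congr_of_eventuallyEq ?_
    filter_upwards [extChartAt_target_mem_nhds x₀] with y hy
    have hx : (extChartAt I x₀).symm y ∈ (chartAt H x₀).source := by
      simpa using (extChartAt I x₀).map_target hy
    ext u v
    rw [inChart_apply g hy]
    exact (trivializationAt_bilin_apply hx _ u v).symm
  eventually_symm := .of_forall fun y u v ↦ g.symm _ _ _
  eventually_isInvertible := by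
    filter_upwards [extChartAt_target_mem_nhds x₀] with y hy
    have hx : (extChartAt I x₀).symm y ∈ (chartAt H x₀).source := by
      simpa using (extChartAt I x₀).map_target hy
    set x := (extChartAt I x₀).symm y
    have inv1 (u : E) : tangentCoordChange I x₀ x x (tangentCoordChange I x x₀ x u) = u := by
      rw [tangentCoordChange_comp (by simpa using hx), tangentCoordChange_self (by simp)]
    have inv2 (u : E) : tangentCoordChange I x x₀ x (tangentCoordChange I x₀ x x u) = u := by
      rw [tangentCoordChange_comp (by simpa using hx), tangentCoordChange_self (by simpa using hx)]
    refine LocalMetric.isInvertible_of_nondegenerate fun u hu ↦ ?_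
    have h0 := g.nondegenerate x (tangentCoordChange I x₀ x x u) fun w ↦
      (congrArg (fun w' : E ↦ g.inner x (tangentCoordChange I x₀ x x u) w') (inv1 w)).symm.trans
        ((inChart_apply g hy u _).symm.trans (hu (tangentCoordChange I x x₀ x w)))
    rw [← inv2 u]
    exact (congrArg (tangentCoordChange I x x₀ x) h0).trans (map_zero _)

theorem contDiffAt_comp_extChartAt_symm {f : M → ℝ} (hf : ContMDiff I 𝓘(ℝ) ∞ f) (x : M) :
    ContDiffAt ℝ 2 (f ∘ (extChartAt I x).symm) (extChartAt I x x) := by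
  have h : ContMDiffAt 𝓘(ℝ, E) I ∞ (extChartAt I x).symm (extChartAt I x x) :=
    (contMDiffOn_extChartAt_symm x).contMDiffAt (extChartAt_target_mem_nhds x)
  exact ((hf _).comp _ h).contDiffAt.of_le (WithTop.coe_le_coe.2 (le_top : (2 : ℕ∞) ≤ ⊤))

end Chart

section Product

variable {E₁ : Type*} [NormedAddCommGroup E₁] [NormedSpace ℝ E₁] [FiniteDimensional ℝ E₁]
  {H₁ : Type*} [TopologicalSpace H₁] {I₁ : ModelWithCorners ℝ E₁ H₁} [I₁.Boundaryless]
  {B : Type*} [TopologicalSpace B] [ChartedSpace H₁ B] [IsManifold I₁ ∞ B]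
  {E₂ : Type*} [NormedAddCommGroup E₂] [NormedSpace ℝ E₂] [FiniteDimensional ℝ E₂]
  {H₂ : Type*} [TopologicalSpace H₂] {I₂ : ModelWithCorners ℝ E₂ H₂} [I₂.Boundaryless]
  {F : Type*} [TopologicalSpace F] [ChartedSpace H₂ F] [IsManifold I₂ ∞ F]

theorem sbcwp_inChart_eventuallyEq (gB : PseudoRiemannianMetric I₁ B)
    (gF : PseudoRiemannianMetric I₂ F) (ψ : B → ℝ) (hψ : ContMDiff I₁ 𝓘(ℝ) ∞ ψ)
    (hψ_pos : ∀ p, 0 < ψ p) (μ : ℝ) (p : B) (q : F) :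
    (gB.sbcwp gF ψ hψ hψ_pos μ).inChart (p, q) =ᶠ[𝓝 (extChartAt (I₁.prod I₂) (p, q) (p, q))]
      LocalMetric.warped ((fun x ↦ Real.log (ψ x)) ∘ (extChartAt I₁ p).symm) μ
        (gB.inChart p) (gF.inChart q) := by
  filter_upwards [extChartAt_target_mem_nhds (I := I₁.prod I₂) (p, q)] with y hy
  have hy' := hy
  rw [extChartAt_prod, PartialEquiv.prod_target] at hy'
  have hx : (extChartAt (I₁.prod I₂) (p, q)).symm y ∈
      (chartAt (ModelProd H₁ H₂) (p, q)).source := by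
    simpa using (extChartAt (I₁.prod I₂) (p, q)).map_target hy
  have hxe : (extChartAt (I₁.prod I₂) (p, q)).symm y =
      ((extChartAt I₁ p).symm y.1, (extChartAt I₂ q).symm y.2) := by
    rw [extChartAt_prod]
    rfl
  refine ContinuousLinearMap.ext fun u ↦ ContinuousLinearMap.ext fun v ↦ ?_
  have hpos := hψ_pos ((extChartAt I₁ p).symm y.1)
  rw [inChart_apply _ hy, LocalMetric.warped_apply, inChart_apply _ hy'.1, inChart_apply _ hy'.2,
    tangentCoordChange_prod hx, Function.comp_apply, Real.exp_log hpos, mul_comm μ,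
    ← Real.rpow_def_of_pos hpos]
  refine (warpedForm_apply gB gF _ _ _ _ _).trans ?_
  rw [hxe]
  rfl

/-- The Ricci tensor of `ψ^(2μ) g_B ⊕ ψ² g_F` in terms of `log ψ`. -/
theorem ricci_sbcwp (gB : PseudoRiemannianMetric I₁ B)
    (gF : PseudoRiemannianMetric I₂ F) (ψ : B → ℝ) (hψ : ContMDiff I₁ 𝓘(ℝ) ∞ ψ)
    (hψ_pos : ∀ p, 0 < ψ p) (μ : ℝ) (p : B) (q : F) {D : ℝ}
    (hD : D = ((finrank ℝ E₁ : ℝ) - 2) * μ + finrank ℝ E₂) (u v : E₁ × E₂) :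
    let f := (fun x ↦ Real.log (ψ x)) ∘ (extChartAt I₁ p).symm
    let y := extChartAt I₁ p p
    (gB.sbcwp gF ψ hψ hψ_pos μ).ricci (p, q) u v =
      gB.ricci p u.1 v.1 + gF.ricci q u.2 v.2 -
      D * LocalMetric.hessian (gB.inChart p) f y u.1 v.1 +
      (μ * D + finrank ℝ E₂ * (μ - 1)) * (fderiv ℝ f y u.1 * fderiv ℝ f y v.1) -
      (LocalMetric.laplacian (gB.inChart p) f y +
        D * fderiv ℝ f y (LocalMetric.gradient (gB.inChart p) f y)) *
        (μ * gB.inner p u.1 v.1 + (ψ p ^ (2 * (μ - 1)))⁻¹ * gF.inner q u.2 v.2) := by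
  intro f y
  have hf : ContDiffAt ℝ 2 f y :=
    (contDiffAt_comp_extChartAt_symm hψ p).log (by simpa using (hψ_pos _).ne')
  have hfy : f y = Real.log (ψ p) := by simp [f, y]
  have hp : ψ p ^ (2 * (μ - 1)) = Real.exp (2 * ((μ - 1) * f y)) := by
    rw [hfy, Real.rpow_def_of_pos (hψ_pos p)]
    ring_nf
  have key := LocalMetric.ricci_warped (y := extChartAt (I₁.prod I₂) (p, q) (p, q))
    (by exact gB.isMetricAt_inChart p) (by exact gF.isMetricAt_inChart q) hf hD u v
  rw [← LocalMetric.ricci_congr (sbcwp_inChart_eventuallyEq gB gF ψ hψ hψ_pos μ p q)] at key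
  refine key.trans ?_
  rw [hp, ← inChart_self gB p, ← inChart_self gF q]
  rfl

end Product

section Powers

variable {E : Type*} [NormedAddCommGroup E] [NormedSpace ℝ E] [FiniteDimensional ℝ E]
  {H : Type*} [TopologicalSpace H] {I : ModelWithCorners ℝ E H} [I.Boundaryless]
  {M : Type*} [TopologicalSpace M] [ChartedSpace H M] [IsManifold I ∞ M]

theorem rpow_comp_eq_exp_log {ψ : M → ℝ} (hψ_pos : ∀ p, 0 < ψ p) (t : ℝ) (p : M) :
    (fun x ↦ ψ x ^ t) ∘ (extChartAt I p).symm =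
      fun z ↦ Real.exp (t * ((fun x ↦ Real.log (ψ x)) ∘ (extChartAt I p).symm) z) := by
  ext z
  simp only [Function.comp_apply]
  rw [Real.rpow_def_of_pos (hψ_pos _), mul_comm]

theorem hessian_rpow (g : PseudoRiemannianMetric I M) {ψ : M → ℝ} (hψ : ContMDiff I 𝓘(ℝ) ∞ ψ)
    (hψ_pos : ∀ p, 0 < ψ p) (t : ℝ) (p : M) (u v : E) :
    let f := (fun x ↦ Real.log (ψ x)) ∘ (extChartAt I p).symm
    let y := extChartAt I p p
    g.hessian (fun x ↦ ψ x ^ t) p u v = ψ p ^ t *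
      (t * LocalMetric.hessian (g.inChart p) f y u v +
        t ^ 2 * (fderiv ℝ f y u * fderiv ℝ f y v)) := by
  intro f y
  have hf : ContDiffAt ℝ 2 f y :=
    (contDiffAt_comp_extChartAt_symm hψ p).log (by simpa using (hψ_pos _).ne')
  have hfy : f y = Real.log (ψ p) := by simp [f, y]
  change LocalMetric.hessian (g.inChart p) ((fun x ↦ ψ x ^ t) ∘ (extChartAt I p).symm) y u v = _
  rw [rpow_comp_eq_exp_log hψ_pos, LocalMetric.hessian_exp_mul hf, hfy, mul_comm t,
    ← Real.rpow_def_of_pos (hψ_pos p)]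
  rfl

theorem laplacian_rpow (g : PseudoRiemannianMetric I M) {ψ : M → ℝ}
    (hψ : ContMDiff I 𝓘(ℝ) ∞ ψ) (hψ_pos : ∀ p, 0 < ψ p) (t : ℝ) (p : M) :
    let f := (fun x ↦ Real.log (ψ x)) ∘ (extChartAt I p).symm
    let y := extChartAt I p p
    g.laplacian (fun x ↦ ψ x ^ t) p = ψ p ^ t *
      (t * LocalMetric.laplacian (g.inChart p) f y +
        t ^ 2 * fderiv ℝ f y (LocalMetric.gradient (g.inChart p) f y)) := by
  intro f y
  have hf : ContDiffAt ℝ 2 f y :=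
    (contDiffAt_comp_extChartAt_symm hψ p).log (by simpa using (hψ_pos _).ne')
  have hfy : f y = Real.log (ψ p) := by simp [f, y]
  rw [laplacian, rpow_comp_eq_exp_log hψ_pos, LocalMetric.laplacian_exp_mul hf, hfy, mul_comm t,
    ← Real.rpow_def_of_pos (hψ_pos p)]

end Powers

end PseudoRiemannianMetric

theorem LocalMetric.ricci_zero_left {E : Type*} [NormedAddCommGroup E] [NormedSpace ℝ E]
    (G : E → E →L[ℝ] E →L[ℝ] ℝ) (y v : E) : LocalMetric.ricci G y 0 v = 0 := by
  rw [LocalMetric.ricci_eq_trace (L := 0) fun e ↦ by simp [LocalMetric.curvature], map_zero]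

theorem LocalMetric.ricci_zero_right {E : Type*} [NormedAddCommGroup E] [NormedSpace ℝ E]
    (G : E → E →L[ℝ] E →L[ℝ] ℝ) (y u : E) : LocalMetric.ricci G y u 0 = 0 := by
  rw [LocalMetric.ricci_eq_trace (L := 0) fun e ↦ by simp [LocalMetric.curvature], map_zero]

theorem sq_sub_two_mul_add_ne_zero {b x : ℝ} (hb : b ≤ 0) (h₁ : x ≠ b + √(b ^ 2 - b))
    (h₂ : x ≠ b - √(b ^ 2 - b)) : x ^ 2 - 2 * b * x + b ≠ 0 := by
  have hs : √(b ^ 2 - b) ^ 2 = b ^ 2 - b := Real.sq_sqrt (by nlinarith)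
  intro h
  have : (x - (b + √(b ^ 2 - b))) * (x - (b - √(b ^ 2 - b))) = 0 := by linear_combination h - hs
  rcases mul_eq_zero.1 this with h | h
  · exact h₁ (sub_eq_zero.1 h)
  · exact h₂ (sub_eq_zero.1 h)

end

theorem mainTheorem2
    {E₁ : Type*} [NormedAddCommGroup E₁] [NormedSpace ℝ E₁] [FiniteDimensional ℝ E₁]
    {H₁ : Type*} [TopologicalSpace H₁] (I₁ : ModelWithCorners ℝ E₁ H₁) [I₁.Boundaryless]
    {B : Type*} [TopologicalSpace B] [ChartedSpace H₁ B] [IsManifold I₁ ∞ B]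
    {E₂ : Type*} [NormedAddCommGroup E₂] [NormedSpace ℝ E₂] [FiniteDimensional ℝ E₂]
    {H₂ : Type*} [TopologicalSpace H₂] (I₂ : ModelWithCorners ℝ E₂ H₂) [I₂.Boundaryless]
    {F : Type*} [TopologicalSpace F] [ChartedSpace H₂ F] [IsManifold I₂ ∞ F]
    (m k : ℕ) (hm : 3 ≤ m) (hk : 1 ≤ k)
    (hB : finrank ℝ E₁ = m) (hF : finrank ℝ E₂ = k)
    (gB : PseudoRiemannianMetric I₁ B) (gF : PseudoRiemannianMetric I₂ F)
    (ψ : B → ℝ) (hψ : ContMDiff I₁ 𝓘(ℝ) ∞ ψ) (hψ_pos : ∀ p, 0 < ψ p)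
    (μ μbar : ℝ) (hμbar : μbar = -(k : ℝ) / ((m : ℝ) - 2))
    (hμ_zero : μ ≠ 0) (hμ_one : μ ≠ 1) (hμ_bar : μ ≠ μbar)
    (hμ_plus : μ ≠ μbar + √(μbar ^ 2 - μbar)) (hμ_minus : μ ≠ μbar - √(μbar ^ 2 - μbar))
    (αΔ βΔ αH βH : ℝ)
    (hαΔ : αΔ = 1 / (((m : ℝ) - 2) * μ + k))
    (hβΔ : βΔ = μ / (((m : ℝ) - 2) * μ + k))
    (hαH : αH = -(((m : ℝ) - 2) * μ + k) / (μ * (((m : ℝ) - 2) * μ + k) + k * (μ - 1)))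
    (hβH : βH = (((m : ℝ) - 2) * μ + k) ^ 2 / (μ * (((m : ℝ) - 2) * μ + k) + k * (μ - 1)))
    (p : B) (q : F) :
    (∀ X Y : TangentSpace I₁ p,
      (gB.sbcwp gF ψ hψ hψ_pos μ).ricci (p, q)
          (PseudoRiemannianMetric.liftBase I₁ I₂ p q X)
          (PseudoRiemannianMetric.liftBase I₁ I₂ p q Y) =
        gB.ricci p X Y +
          βH * (1 / ψ p ^ (1 / αH)) * gB.hessian (fun x ↦ ψ x ^ (1 / αH)) p X Y -
          βΔ * (1 / ψ p ^ (1 / αΔ)) * gB.laplacian (fun x ↦ ψ x ^ (1 / αΔ)) p *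
            gB.inner p X Y) ∧
    (∀ (X : TangentSpace I₁ p) (V : TangentSpace I₂ q),
      (gB.sbcwp gF ψ hψ hψ_pos μ).ricci (p, q)
          (PseudoRiemannianMetric.liftBase I₁ I₂ p q X)
          (PseudoRiemannianMetric.liftFiber I₁ I₂ p q V) = 0 ∧
      (gB.sbcwp gF ψ hψ hψ_pos μ).ricci (p, q)
          (PseudoRiemannianMetric.liftFiber I₁ I₂ p q V)
          (PseudoRiemannianMetric.liftBase I₁ I₂ p q X) = 0) ∧
    (∀ V W : TangentSpace I₂ q,
      (gB.sbcwp gF ψ hψ hψ_pos μ).ricci (p, q)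
          (PseudoRiemannianMetric.liftFiber I₁ I₂ p q V)
          (PseudoRiemannianMetric.liftFiber I₁ I₂ p q W) =
        gF.ricci q V W -
          1 / ψ p ^ (2 * (μ - 1)) * (βΔ / μ) *
            (1 / ψ p ^ (1 / αΔ)) * gB.laplacian (fun x ↦ ψ x ^ (1 / αΔ)) p *
            gF.inner q V W) := by
  have hm2 : (0 : ℝ) < (m : ℝ) - 2 := by
    have : (3 : ℝ) ≤ m := by exact_mod_cast hm
    linarith
  set D : ℝ := ((m : ℝ) - 2) * μ + k with hD
  set N : ℝ := μ * D + k * (μ - 1) with hN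
  have hkμ : (k : ℝ) = -μbar * ((m : ℝ) - 2) := by
    rw [hμbar]
    field_simp
  have hD0 : D ≠ 0 := by
    have : D = ((m : ℝ) - 2) * (μ - μbar) := by rw [hD, hkμ]; ring
    rw [this]
    exact mul_ne_zero hm2.ne' (sub_ne_zero.2 hμ_bar)
  have hN0 : N ≠ 0 := by
    have h1 : N = ((m : ℝ) - 2) * (μ ^ 2 - 2 * μbar * μ + μbar) := by rw [hN, hD, hkμ]; ring
    have h2 : μbar ≤ 0 := by
      rw [hμbar, neg_div]
      exact neg_nonpos.2 (by positivity)
    rw [h1]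
    exact mul_ne_zero hm2.ne' (sq_sub_two_mul_add_ne_zero h2 hμ_plus hμ_minus)
  have hΔ : 1 / αΔ = D := by rw [hαΔ, one_div_one_div]
  have hH : 1 / αH = -(N / D) := by rw [hαH, one_div_div, div_neg]
  have hψt (t : ℝ) : ψ p ^ t ≠ 0 := (Real.rpow_pos_of_pos (hψ_pos p) t).ne'
  have key := gB.ricci_sbcwp gF ψ hψ hψ_pos μ p q (D := D) (by rw [hB, hF])
  rw [hF] at key
  rw [hΔ, hH, gB.laplacian_rpow hψ hψ_pos]
  refine ⟨fun X Y ↦ (key (X, 0) (Y, 0)).trans ?_,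
    fun X V ↦ ⟨(key (X, 0) (0, V)).trans ?_, (key (0, V) (X, 0)).trans ?_⟩,
    fun V W ↦ (key (0, V) (0, W)).trans ?_⟩
  · have h0 : gF.ricci q 0 0 = 0 := LocalMetric.ricci_zero_left _ _ _
    have h1 : gF.inner q 0 0 = 0 := by simp
    have hess := gB.hessian_rpow hψ hψ_pos (-(N / D)) p X Y
    have hP := hψt (-(N / D))
    have hQ := hψt D
    dsimp only at hess ⊢
    rw [hess, hβH, hβΔ]
    erw [h0, h1]
    generalize ψ p ^ (-(N / D)) = P at *
    generalize ψ p ^ D = Q at *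
    field_simp
    ring
  · have h0 : gB.ricci p X 0 = 0 := LocalMetric.ricci_zero_right _ _ _
    have h1 : gF.ricci q 0 V = 0 := LocalMetric.ricci_zero_left _ _ _
    have h2 : gB.inner p X 0 = 0 := by simp
    have h3 : gF.inner q 0 V = 0 := by simp
    dsimp only
    erw [h0, h1, h2, h3]
    simp
  · have h0 : gB.ricci p 0 X = 0 := LocalMetric.ricci_zero_left _ _ _
    have h1 : gF.ricci q V 0 = 0 := LocalMetric.ricci_zero_right _ _ _
    have h2 : gB.inner p 0 X = 0 := by simp
    have h3 : gF.inner q V 0 = 0 := by simp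
    dsimp only
    erw [h0, h1, h2, h3]
    simp
    exact Or.inr rfl
  · have h0 : gB.ricci p 0 0 = 0 := LocalMetric.ricci_zero_left _ _ _
    have h1 : gB.inner p 0 0 = 0 := by simp
    have hP := hψt (2 * (μ - 1))
    have hQ := hψt D
    dsimp only
    erw [h0, h1]
    simp only [map_zero, hβΔ]
    generalize ψ p ^ (2 * (μ - 1)) = P at *
    generalize ψ p ^ D = Q at *
    field_simp
    ring
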